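/- There is a universal constant $C>0$ such that the following holds. Let $\Delta,q$ be non-negative integers with $q>C\Delta^2$, let $G$ be a finite simple graph of maximum degree at most $\Delta$, and let $L$ assign to each vertex $w$ of $G$ a set $L(w)\subset\mathbb{N}$ of exactly $q$ colors, written in ascending order as $c_{1,w}<\dots<c_{q,w}$. A family $\omega=(\omega_w)_{w\in V(G)}$ of permutations in $S_q$ is called an $L$-packing if each of the $q$ maps $f_i(w)=c_{\omega_w(i),w}$, $i\in[q]$, is a proper coloring of $G$ (these maps are automatically pairwise disjoint). For a vertex $u$, the availability graph $H_u(\omega)$ is the bipartite graph on $[q]\sqcup[q]$ in which $i$ on the left is joined to $j$ on the right if and only if $c_{j,u}\notin f_i(N(u))$; its perfect matchings are identified with the permutations $\rho\in S_q$ such that $(i,\rho(i))$ is an edge for every $i\in[q]$. Let $d_{\mathrm C}(\rho,\rho')$ denote the Cayley distance on $S_q$, i.e. the minimum number of transpositions that one must compose with $\rho$ to obtain $\rho'$. Let $\omega,\omega'$ be two $L$-packings that differ at exactly one vertex $v$, and let $\psi=d_{\mathrm C}(\omega_v,\omega'_v)$. Then for every neighbor $u$ of $v$ the graphs $H_u(\omega)$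 and $H_u(\omega')$ have perfect matchings, and there is a coupling $\gamma$ of the uniform distribution on the perfect matchings of $H_u(\omega)$ and the uniform distribution on the perfect matchings of $H_u(\omega')$ such that \[ \mathbb{E}_{(\rho,\rho')\sim\gamma}\bigl[d_{\mathrm C}(\rho,\rho')\bigr]\le\frac{\psi}{2\Delta}. \] -/

import Mathlib

/-!
Definitions for list packings, availability graphs, the Cayley metric and couplings.
Colors are natural numbers, `L v` is the list of colors of the vertex `v`, every list has `q` colors,
and the indices in `[q]` are the elements of `Fin q`.
-/

namespace ListPacking

/-- The colors of the list `L v` in ascending order: `listColor L hL v j` is the `j`-th one. -/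
def listColor {V : Type*} {q : ℕ} (L : V → Finset ℕ) (hL : ∀ v, (L v).card = q)
    (v : V) (j : Fin q) : ℕ :=
  (L v).orderEmbOfFin (hL v) j

/-- The map `f_i : V → ℕ` represented by `ω ∈ S_q^V` at packing index `i`: the vertex `v`
receives the `ω_v(i)`-th color of its list. -/
def coloring {V : Type*} {q : ℕ} (L : V → Finset ℕ) (hL : ∀ v, (L v).card = q)
    (ω : V → Equiv.Perm (Fin q)) (i : Fin q) (v : V) : ℕ :=
  listColor L hL v (ω v i)

/-- `f` is an `L`-coloring of `G`: a proper coloring with `f v ∈ L v` for all vertices `v`. -/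
def IsListColoring {V : Type*} (G : SimpleGraph V) (L : V → Finset ℕ) (f : V → ℕ) : Prop :=
  (∀ v, f v ∈ L v) ∧ ∀ v w, G.Adj v w → f v ≠ f w

/-- `ω ∈ S_q^V` represents an `L`-packing of `G`: the maps `f_1, …, f_q` are
pairwise disjoint `L`-colorings. -/
def IsListPacking {V : Type*} {q : ℕ} (G : SimpleGraph V) (L : V → Finset ℕ)
    (hL : ∀ v, (L v).card = q) (ω : V → Equiv.Perm (Fin q)) : Prop :=
  (∀ i, IsListColoring G L (coloring L hL ω i)) ∧
    ∀ i j, i ≠ j → ∀ v, coloring L hL ω i v ≠ coloring L hL ω j v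

/-- The availability graph `H_u(G, L, ω)`, a bipartite graph on `[q] ⊔ [q]`. The left copy holds the
packing indices `i`, the right copy the list indices `j`, and `i` is joined to `j` if and only if
the `j`-th color of `L u` does not lie in `f_i(N(u))`. -/
def availabilityGraph {V : Type*} {q : ℕ} (G : SimpleGraph V) (L : V → Finset ℕ)
    (hL : ∀ v, (L v).card = q) (ω : V → Equiv.Perm (Fin q)) (u : V) :
    SimpleGraph (Fin q ⊕ Fin q) where
  Adj x y :=
    match x, y with
    | Sum.inl i, Sum.inr j => listColor L hL u j ∉ coloring L hL ω i '' G.neighborSet u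
    | Sum.inr j, Sum.inl i => listColor L hL u j ∉ coloring L hL ω i '' G.neighborSet u
    | Sum.inl _, Sum.inl _ => False
    | Sum.inr _, Sum.inr _ => False
  symm := ⟨by rintro (i | i) (j | j) h <;> exact h⟩
  loopless := ⟨by rintro (i | i) h <;> exact h⟩

open Classical in
/-- The perfect matchings of a balanced bipartite graph `H` on `[q] ⊔ [q]`, as the set of the
permutations `ρ` of `[q]` such that `i` on the left is joined to `ρ i` on the right for all `i`. -/
noncomputable def perfectMatchings {q : ℕ} (H : SimpleGraph (Fin q ⊕ Fin q)) :
    Finset (Equiv.Perm (Fin q)) :=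
  Finset.univ.filter fun ρ => ∀ i, H.Adj (Sum.inl i) (Sum.inr (ρ i))

theorem mem_perfectMatchings {q : ℕ} (H : SimpleGraph (Fin q ⊕ Fin q))
    (ρ : Equiv.Perm (Fin q)) :
    ρ ∈ perfectMatchings H ↔ ∀ i, H.Adj (Sum.inl i) (Sum.inr (ρ i)) := by
  simp [perfectMatchings]

/-- The Cayley metric on `S_q`: the least number of transpositions that one has to compose with
`ρ` to turn it into `ρ'`. -/
noncomputable def cayleyDist {q : ℕ} (ρ ρ' : Equiv.Perm (Fin q)) : ℕ :=
  sInf {k : ℕ | ∃ l : List (Equiv.Perm (Fin q)),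
    l.length = k ∧ (∀ τ ∈ l, τ.IsSwap) ∧ l.prod * ρ = ρ'}

/-- The set in `cayleyDist` is never empty, so that its infimum is a minimum. -/
theorem exists_length_eq_cayleyDist {q : ℕ} (ρ ρ' : Equiv.Perm (Fin q)) :
    ∃ l : List (Equiv.Perm (Fin q)),
      l.length = cayleyDist ρ ρ' ∧ (∀ τ ∈ l, τ.IsSwap) ∧ l.prod * ρ = ρ' := by
  have h : {k : ℕ | ∃ l : List (Equiv.Perm (Fin q)),
      l.length = k ∧ (∀ τ ∈ l, τ.IsSwap) ∧ l.prod * ρ = ρ'}.Nonempty := by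
    obtain ⟨l, hl, hs⟩ := (Equiv.Perm.truncSwapFactors (ρ' * ρ⁻¹)).out
    exact ⟨l.length, l, rfl, hs, by rw [hl]; simp⟩
  exact Nat.sInf_mem h

/-- `γ` is a coupling of the distributions `μ` and `ν`: its marginals are `μ` and `ν`. -/
def IsCoupling {α β : Type*} (γ : PMF (α × β)) (μ : PMF α) (ν : PMF β) : Prop :=
  γ.map Prod.fst = μ ∧ γ.map Prod.snd = ν

/-- The expected Cayley distance `𝔼_{(ρ, ρ') ∼ γ} d_C(ρ, ρ')`. -/
noncomputable def expectedCayleyDist {q : ℕ}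
    (γ : PMF (Equiv.Perm (Fin q) × Equiv.Perm (Fin q))) : ℝ :=
  ∑ p, (γ p).toReal * (cayleyDist p.1 p.2 : ℝ)

end ListPacking

open Finset

namespace ListPacking

/-! Perfect matchings of the availability graph at `u` are the permutations avoiding a set of
forbidden cells with at most Δ cells in each line. Let F and F' be these sets for the two packings.
Only cells created by `v` in rows where the two permutations at `v` differ can lie in one set and
not the other, so each difference has at most 2ψ cells (`card_forbidden_sdiff_le`). The uniform
distribution is moved from F to F ∪ F' by adding cells one at a time, and then back down to F' by
symmetry. All intermediate sets have at most D = 2Δ cells per line.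

It remains to add one cell (i, j) at cost 12D/q (`transportLE_avoiding_insert`). Let X be the set of
permutations avoiding F; split it into Y, which avoids (i, j), and Z, which uses it. Mass on Y stays
put. Mass at ρ in Z is spread over the permutations ρ ∘ (i k) in Y, at distance 1. At least q - 2D -
1 values of k work, and ρ is recovered from the result by bringing j back to i, so |Z|/|X| = O(1/q).
All but a fraction 2D/q of Y is reached, by a second switching argument. Hence an almost constant
weight per switch fits both marginals, and only O(D/q²) of the mass is left over. Since the Cayley
diameter is at most q, this remainder also costs O(D/q).

Altogether at most 4ψ cells are added or removed, each at cost 24Δ/q, and 96ψΔ/q ≤ ψ/(2Δ) once q ≥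
192Δ². -/

/-- The density of the uniform distribution on a finite set. -/
noncomputable def uniformWeight {α : Type*} [DecidableEq α] (s : Finset α) (a : α) : ℝ :=
  if a ∈ s then (s.card : ℝ)⁻¹ else 0

theorem uniformWeight_nonneg {α : Type*} [DecidableEq α] (s : Finset α) (a : α) :
    0 ≤ uniformWeight s a := by
  unfold uniformWeight
  split_ifs <;> positivity

/-! ### Transport plans between weights on a finite set. -/

section Transport

variable {α : Type*} [Fintype α]

/-- There is a transport plan from the weight `μ` to the weight `ν` whose total cost with respect to
`d` is at most `c`. -/
def TransportLE (d : α → α → ℝ) (μ ν : α → ℝ) (c : ℝ) : Prop :=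
  ∃ m : α → α → ℝ, (∀ a b, 0 ≤ m a b) ∧ (∀ a, ∑ b, m a b = μ a) ∧ (∀ b, ∑ a, m a b = ν b) ∧
    ∑ a, ∑ b, m a b * d a b ≤ c

theorem TransportLE.refl [DecidableEq α] {d : α → α → ℝ} (hd : ∀ a, d a a = 0) {μ : α → ℝ}
    (hμ : ∀ a, 0 ≤ μ a) : TransportLE d μ μ 0 := by
  refine ⟨fun a b => if a = b then μ a else 0, fun a b => ?_, fun a => ?_, fun b => ?_, ?_⟩
  · dsimp only
    split_ifs
    exacts [hμ a, le_rfl]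
  · simp
  · simp
  · simp [hd]

theorem TransportLE.symm {d : α → α → ℝ} (hd : ∀ a b, d a b = d b a) {μ ν : α → ℝ} {c : ℝ}
    (h : TransportLE d μ ν c) : TransportLE d ν μ c := by
  obtain ⟨m, h0, h1, h2, h3⟩ := h
  refine ⟨fun a b => m b a, fun a b => h0 b a, h2, h1, ?_⟩
  rw [Finset.sum_comm]
  simpa only [hd] using h3

/-- Transport plans are glued along a common marginal. -/
theorem TransportLE.trans {d : α → α → ℝ} (hd : ∀ a b c, d a c ≤ d a b + d b c)
    {μ ν κ : α → ℝ} {c c' : ℝ} (h : TransportLE d μ ν c) (h' : TransportLE d ν κ c') :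
    TransportLE d μ κ (c + c') := by
  obtain ⟨m, h0, h1, h2, h3⟩ := h
  obtain ⟨n, k0, k1, k2, k3⟩ := h'
  have hν : ∀ b, 0 ≤ ν b := fun b => h2 b ▸ sum_nonneg fun a _ => h0 a b
  -- The glued plan makes the two legs conditionally independent given b. Where ν b = 0 the division
  -- returns 0, which is right because all of `m a b` vanishes there.
  have hm : ∀ a b, m a b * ν b / ν b = m a b := fun a b => by
    by_cases hb : ν b = 0
    · have : m a b = 0 := by
        have := h2 b
        rw [hb, sum_eq_zero_iff_of_nonneg fun a _ => h0 a b] at this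
        exact this a (mem_univ a)
      simp [this]
    · field_simp
  have hn : ∀ b a, n b a * ν b / ν b = n b a := fun b a => by
    by_cases hb : ν b = 0
    · have : n b a = 0 := by
        have := k1 b
        rw [hb, sum_eq_zero_iff_of_nonneg fun a _ => k0 b a] at this
        exact this a (mem_univ a)
      simp [this]
    · field_simp
  have e1 : ∀ a b, ∑ e, m a b * n b e / ν b = m a b := fun a b => by
    rw [← Finset.sum_div, ← Finset.mul_sum, k1, hm]
  have e2 : ∀ b e, ∑ a, m a b * n b e / ν b = n b e := fun b e => by
    rw [← Finset.sum_div, ← Finset.sum_mul, h2, mul_comm, hn]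
  have hp : ∀ a b e, 0 ≤ m a b * n b e / ν b := fun a b e =>
    div_nonneg (mul_nonneg (h0 a b) (k0 b e)) (hν b)
  refine ⟨fun a e => ∑ b, m a b * n b e / ν b, fun a e => sum_nonneg fun b _ => hp a b e,
    fun a => ?_, fun e => ?_, ?_⟩
  · rw [Finset.sum_comm]
    simp only [e1, h1]
  · rw [Finset.sum_comm]
    simp only [e2, k2]
  · calc ∑ a, ∑ e, (∑ b, m a b * n b e / ν b) * d a e
        ≤ ∑ a, ∑ e, ∑ b, (m a b * n b e / ν b * d a b + m a b * n b e / ν b * d b e) := by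
          refine sum_le_sum fun a _ => sum_le_sum fun e _ => ?_
          rw [Finset.sum_mul]
          refine sum_le_sum fun b _ => ?_
          rw [← mul_add]
          exact mul_le_mul_of_nonneg_left (hd a b e) (hp a b e)
      _ = (∑ a, ∑ b, m a b * d a b) + ∑ b, ∑ e, n b e * d b e := by
          simp only [sum_add_distrib]
          congr 1
          · refine sum_congr rfl fun a _ => ?_
            rw [Finset.sum_comm]
            simp only [← Finset.sum_mul, e1]
          · rw [Finset.sum_comm]
            simp_rw [Finset.sum_comm (s := (univ : Finset α)) (t := (univ : Finset α))
              (f := fun a b => m a b * n b _ / ν b * d b _), ← Finset.sum_mul, e2]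
            rw [Finset.sum_comm]
      _ ≤ c + c' := add_le_add h3 k3

theorem TransportLE.mono {d : α → α → ℝ} {μ ν : α → ℝ} {c c' : ℝ}
    (h : TransportLE d μ ν c) (hc : c ≤ c') : TransportLE d μ ν c' := by
  obtain ⟨m, h0, h1, h2, h3⟩ := h
  exact ⟨m, h0, h1, h2, h3.trans hc⟩

/-- A partial transport plan is completed by moving the remaining mass at the largest cost. -/
theorem TransportLE.of_partial {d : α → α → ℝ} {M : ℝ} (hd : ∀ a b, d a b ≤ M)
    {μ ν : α → ℝ} (hμ : ∑ a, μ a = 1) (hν : ∑ a, ν a = 1) (m : α → α → ℝ)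
    (h0 : ∀ a b, 0 ≤ m a b) (h1 : ∀ a, ∑ b, m a b ≤ μ a) (h2 : ∀ b, ∑ a, m a b ≤ ν b) :
    TransportLE d μ ν (∑ a, ∑ b, m a b * d a b + (1 - ∑ a, ∑ b, m a b) * M) := by
  set s := ∑ a, ∑ b, m a b with hs
  set r : α → ℝ := fun a => μ a - ∑ b, m a b with hr
  set t : α → ℝ := fun b => ν b - ∑ a, m a b with ht
  have r0 : ∀ a, 0 ≤ r a := fun a => sub_nonneg.2 (h1 a)
  have t0 : ∀ a, 0 ≤ t a := fun a => sub_nonneg.2 (h2 a)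
  have rs : ∑ a, r a = 1 - s := by simp only [hr, sum_sub_distrib, hμ, hs]
  have ts : ∑ a, t a = 1 - s := by
    simp only [ht, sum_sub_distrib, hν, hs]
    rw [Finset.sum_comm]
  have s0 : 0 ≤ 1 - s := rs ▸ sum_nonneg fun a _ => r0 a
  have er : ∀ a, r a * (1 - s) / (1 - s) = r a := fun a => by
    by_cases h : 1 - s = 0
    · rw [h, sum_eq_zero_iff_of_nonneg fun a _ => r0 a] at rs
      simp [rs a (mem_univ a)]
    · field_simp
  have et : ∀ a, t a * (1 - s) / (1 - s) = t a := fun a => by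
    by_cases h : 1 - s = 0
    · rw [h, sum_eq_zero_iff_of_nonneg fun a _ => t0 a] at ts
      simp [ts a (mem_univ a)]
    · field_simp
  have e1 : ∀ a, ∑ b, r a * t b / (1 - s) = r a := fun a => by
    rw [← Finset.sum_div, ← Finset.mul_sum, ts, er]
  have e2 : ∀ b, ∑ a, r a * t b / (1 - s) = t b := fun b => by
    rw [← Finset.sum_div, ← Finset.sum_mul, rs, mul_comm, et]
  have hp : ∀ a b, 0 ≤ r a * t b / (1 - s) := fun a b =>
    div_nonneg (mul_nonneg (r0 a) (t0 b)) s0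
  -- The leftover marginals r and t have the same mass 1 - s and are joined by their normalized
  -- product. If s = 1 both vanish, so division by 0 does no harm.
  refine ⟨fun a b => m a b + r a * t b / (1 - s), fun a b => add_nonneg (h0 a b) (hp a b),
    fun a => ?_, fun b => ?_, ?_⟩
  · rw [sum_add_distrib, e1]
    simp [hr]
  · rw [sum_add_distrib, e2]
    simp [ht]
  · simp only [add_mul, sum_add_distrib]
    refine add_le_add le_rfl ?_
    calc ∑ a, ∑ b, r a * t b / (1 - s) * d a b ≤ ∑ a, ∑ b, r a * t b / (1 - s) * M :=
          sum_le_sum fun a _ => sum_le_sum fun b _ => mul_le_mul_of_nonneg_left (hd a b) (hp a b)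
      _ = (1 - s) * M := by simp only [← Finset.sum_mul, e1, rs]

theorem sum_uniformWeight [DecidableEq α] {s : Finset α} (hs : s.Nonempty) :
    ∑ a, uniformWeight s a = 1 := by
  have : (s.card : ℝ) ≠ 0 := by simpa using hs.ne_empty
  simp [uniformWeight, this]

/-- A transport plan between uniform weights is a coupling of the uniform distributions. -/
theorem TransportLE.exists_coupling [DecidableEq α] {d : α → α → ℝ} {s t : Finset α}
    (hs : s.Nonempty) (ht : t.Nonempty) {c : ℝ}
    (h : TransportLE d (uniformWeight s) (uniformWeight t) c) :
    ∃ γ : PMF (α × α), γ.map Prod.fst = PMF.uniformOfFinset s hs ∧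
      γ.map Prod.snd = PMF.uniformOfFinset t ht ∧ ∑ p, (γ p).toReal * d p.1 p.2 ≤ c := by
  obtain ⟨m, h0, h1, h2, h3⟩ := h
  have hw : ∀ (s : Finset α) (hs : s.Nonempty) (a : α),
      ENNReal.ofReal (uniformWeight s a) = PMF.uniformOfFinset s hs a := fun s hs a => by
    rw [PMF.uniformOfFinset_apply, uniformWeight]
    split_ifs
    · rw [ENNReal.ofReal_inv_of_pos (by simpa [Finset.card_pos] using hs), ENNReal.ofReal_natCast]
    · simp
  have hsum : ∑ p : α × α, ENNReal.ofReal (m p.1 p.2) = 1 := by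
    rw [← ENNReal.ofReal_sum_of_nonneg fun p _ => h0 p.1 p.2, Fintype.sum_prod_type]
    simp only [h1, sum_uniformWeight hs, ENNReal.ofReal_one]
  refine ⟨PMF.ofFintype _ hsum, ?_, ?_, ?_⟩
  · ext a
    rw [PMF.map_apply, tsum_fintype, Fintype.sum_prod_type, ← hw, ← h1,
      ENNReal.ofReal_sum_of_nonneg fun b _ => h0 a b]
    rw [Finset.sum_eq_single a (fun x _ hx => by simp [Ne.symm hx]) (by simp)]
    simp
  · ext a
    rw [PMF.map_apply, tsum_fintype, Fintype.sum_prod_type_right, ← hw, ← h2,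
      ENNReal.ofReal_sum_of_nonneg fun b _ => h0 b a]
    rw [Finset.sum_eq_single a (fun x _ hx => by simp [Ne.symm hx]) (by simp)]
    simp
  · rw [Fintype.sum_prod_type]
    simpa [ENNReal.toReal_ofReal, h0] using h3

end Transport

/-! ### The Cayley metric: metric axioms, diameter and supports. -/

section CayleyMetric

variable {q : ℕ}

theorem cayleyDist_le_length {ρ ρ' : Equiv.Perm (Fin q)} {l : List (Equiv.Perm (Fin q))}
    (hl : ∀ τ ∈ l, τ.IsSwap) (h : l.prod * ρ = ρ') : cayleyDist ρ ρ' ≤ l.length :=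
  Nat.sInf_le ⟨l, rfl, hl, h⟩

theorem cayleyDist_self (ρ : Equiv.Perm (Fin q)) : cayleyDist ρ ρ = 0 :=
  Nat.le_zero.1 (cayleyDist_le_length (l := []) (by simp) (by simp))

theorem cayleyDist_triangle (ρ σ τ : Equiv.Perm (Fin q)) :
    cayleyDist ρ τ ≤ cayleyDist ρ σ + cayleyDist σ τ := by
  obtain ⟨l, hl, hs, hp⟩ := exists_length_eq_cayleyDist ρ σ
  obtain ⟨l', hl', hs', hp'⟩ := exists_length_eq_cayleyDist σ τ
  rw [← hl, ← hl', add_comm, ← List.length_append]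
  refine cayleyDist_le_length (fun τ h => ?_) ?_
  · rcases List.mem_append.1 h with h | h
    exacts [hs' τ h, hs τ h]
  · rw [List.prod_append, mul_assoc, hp, hp']

theorem cayleyDist_comm_le (ρ σ : Equiv.Perm (Fin q)) : cayleyDist σ ρ ≤ cayleyDist ρ σ := by
  obtain ⟨l, hl, hs, hp⟩ := exists_length_eq_cayleyDist ρ σ
  have hinv : ∀ τ : Equiv.Perm (Fin q), τ.IsSwap → τ⁻¹ = τ := by
    rintro τ ⟨x, y, -, rfl⟩
    exact Equiv.swap_inv x y
  rw [← hl, ← List.length_reverse]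
  refine cayleyDist_le_length (fun τ h => hs τ (List.mem_reverse.1 h)) ?_
  have : l.reverse.prod = l.prod⁻¹ := by
    rw [List.prod_inv_reverse, List.map_congr_left fun τ h => hinv τ (hs τ h), List.map_id']
  rw [this, ← hp, inv_mul_cancel_left]

theorem cayleyDist_comm (ρ σ : Equiv.Perm (Fin q)) : cayleyDist ρ σ = cayleyDist σ ρ :=
  le_antisymm (cayleyDist_comm_le σ ρ) (cayleyDist_comm_le ρ σ)

theorem cayleyDist_mul_swap_le (ρ : Equiv.Perm (Fin q)) (i k : Fin q) :
    cayleyDist (ρ * Equiv.swap i k) ρ ≤ 1 := by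
  by_cases h : i = k
  · subst h
    simp [cayleyDist_self, ← Equiv.Perm.one_def]
  · refine cayleyDist_le_length (l := [Equiv.swap (ρ i) (ρ k)]) ?_ ?_
    · simp only [List.mem_singleton, forall_eq]
      exact ⟨_, _, by simpa using h, rfl⟩
    · rw [List.prod_singleton, ← mul_assoc, ← Equiv.mul_swap_eq_swap_mul, mul_assoc,
        Equiv.swap_mul_self, mul_one]

/-- Composing with the transposition of x and f x fixes a moved point and moves no new one. This
gives the crude diameter bound q, which suffices here. -/
theorem exists_swaps_of_card_support (n : ℕ) (f : Equiv.Perm (Fin q)) (hf : #f.support ≤ n) :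
    ∃ l : List (Equiv.Perm (Fin q)), l.length ≤ n ∧ (∀ τ ∈ l, τ.IsSwap) ∧ l.prod = f := by
  induction n generalizing f with
  | zero =>
    refine ⟨[], le_rfl, by simp, ?_⟩
    rw [Nat.le_zero, card_eq_zero, Equiv.Perm.support_eq_empty_iff] at hf
    rw [hf, List.prod_nil]
  | succ n ih =>
    by_cases h : f = 1
    · exact ⟨[], by simp, by simp, by simp [h]⟩
    · obtain ⟨x, hx⟩ : ∃ x, f x ≠ x := by
        by_contra! h'
        exact h (Equiv.ext h')
      obtain ⟨l, h1, h2, h3⟩ := ih (Equiv.swap x (f x) * f)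
        (by have := Equiv.Perm.card_support_swap_mul hx; omega)
      refine ⟨Equiv.swap x (f x) :: l, by simpa using h1, ?_, ?_⟩
      · simp only [List.mem_cons, forall_eq_or_imp]
        exact ⟨⟨_, _, Ne.symm hx, rfl⟩, h2⟩
      · rw [List.prod_cons, h3, ← mul_assoc, Equiv.swap_mul_self, one_mul]

theorem cayleyDist_le (ρ σ : Equiv.Perm (Fin q)) : cayleyDist ρ σ ≤ q := by
  obtain ⟨l, h1, h2, h3⟩ := exists_swaps_of_card_support q (σ * ρ⁻¹)
    ((card_le_univ _).trans (by simp))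
  exact (cayleyDist_le_length h2 (by rw [h3, inv_mul_cancel_right])).trans h1

theorem card_support_prod_le (l : List (Equiv.Perm (Fin q))) (hl : ∀ τ ∈ l, τ.IsSwap) :
    #l.prod.support ≤ 2 * l.length := by
  induction l with
  | nil => simp
  | cons τ l ih =>
    rw [List.prod_cons, List.length_cons]
    have h1 := ih fun σ h => hl σ (List.mem_cons_of_mem _ h)
    have h2 : #τ.support = 2 := Equiv.Perm.card_support_eq_two.2 (hl τ List.mem_cons_self)
    have h3 := card_le_card (Equiv.Perm.support_mul_le τ l.prod)
    have h4 := card_union_le τ.support l.prod.support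
    simp only [sup_eq_union] at h3
    omega

/-- Permutations at Cayley distance `k` differ at no more than `2 * k` points. -/
theorem card_ne_le_two_mul_cayleyDist (ρ σ : Equiv.Perm (Fin q)) :
    #{i | ρ i ≠ σ i} ≤ 2 * cayleyDist ρ σ := by
  obtain ⟨l, hl, hs, hp⟩ := exists_length_eq_cayleyDist ρ σ
  rw [← hl]
  refine le_trans ?_ (card_support_prod_le l hs)
  refine card_le_card_of_injOn ρ (fun i hi => ?_) ρ.injective.injOn
  have hi : ρ i ≠ σ i := by simpa using hi
  have : σ i = l.prod (ρ i) := by rw [← hp]; rfl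
  simpa [← this] using hi.symm

end CayleyMetric

/-! ### Permutations avoiding forbidden cells, and switchings. -/

section Avoiding

variable {q : ℕ}

/-- The permutations that use none of the cells of `F`. -/
def avoiding (F : Finset (Fin q × Fin q)) : Finset (Equiv.Perm (Fin q)) :=
  univ.filter fun ρ => ∀ i, (i, ρ i) ∉ F

theorem mem_avoiding {F : Finset (Fin q × Fin q)} {ρ : Equiv.Perm (Fin q)} :
    ρ ∈ avoiding F ↔ ∀ i, (i, ρ i) ∉ F := by simp [avoiding]

/-- Every row and every column contains at most `D` cells of `F`. -/
def LinesLE (F : Finset (Fin q × Fin q)) (D : ℕ) : Prop :=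
  (∀ i, #{j | (i, j) ∈ F} ≤ D) ∧ ∀ j, #{i | (i, j) ∈ F} ≤ D

theorem LinesLE.mono {F F' : Finset (Fin q × Fin q)} {D : ℕ} (h : LinesLE F' D) (hF : F ⊆ F') :
    LinesLE F D :=
  ⟨fun i => (card_le_card (monotone_filter_right _ fun _ _ hj => hF hj)).trans (h.1 i),
    fun j => (card_le_card (monotone_filter_right _ fun _ _ hj => hF hj)).trans (h.2 j)⟩

theorem LinesLE.union {F F' : Finset (Fin q × Fin q)} {D D' : ℕ} (h : LinesLE F D)
    (h' : LinesLE F' D') : LinesLE (F ∪ F') (D + D') := by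
  constructor <;> intro i <;> simp only [mem_union, filter_or] <;>
    refine (card_union_le _ _).trans ?_
  exacts [add_le_add (h.1 i) (h'.1 i), add_le_add (h.2 i) (h'.2 i)]

theorem LinesLE.card_perm_le {F : Finset (Fin q × Fin q)} {D : ℕ} (h : LinesLE F D)
    (i : Fin q) (ρ : Equiv.Perm (Fin q)) : #{k | (i, ρ k) ∈ F} ≤ D :=
  (card_le_card_of_injOn ρ (fun k hk => by simpa using hk) ρ.injective.injOn).trans (h.1 i)

/-- The partners `k` for which exchanging the values at `i` and `k` puts no cell of `F` in use. -/
def switchable (F : Finset (Fin q × Fin q)) (ρ : Equiv.Perm (Fin q)) (i : Fin q) :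
    Finset (Fin q) :=
  univ.filter fun k => k ≠ i ∧ (i, ρ k) ∉ F ∧ (k, ρ i) ∉ F

theorem mem_switchable {F : Finset (Fin q × Fin q)} {ρ : Equiv.Perm (Fin q)} {i k : Fin q} :
    k ∈ switchable F ρ i ↔ k ≠ i ∧ (i, ρ k) ∉ F ∧ (k, ρ i) ∉ F := by simp [switchable]

/-- The excluded partners are i itself, at most D from row i of F, and at most D from column ρ i. -/
theorem le_card_switchable {F : Finset (Fin q × Fin q)} {D : ℕ} (h : LinesLE F D)
    (ρ : Equiv.Perm (Fin q)) (i : Fin q) : q ≤ #(switchable F ρ i) + 2 * D + 1 := by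
  have hsub : (univ : Finset (Fin q)) ⊆ switchable F ρ i ∪
      ((({i} : Finset (Fin q)) ∪ ({k | (i, ρ k) ∈ F} : Finset (Fin q))) ∪ ({k | (k, ρ i) ∈ F} : Finset (Fin q))) := by
    intro k _
    simp only [mem_union, mem_switchable, mem_singleton, mem_filter, mem_univ, true_and]
    tauto
  have h0 := card_le_card hsub
  rw [card_univ, Fintype.card_fin] at h0
  have h1 := card_union_le (switchable F ρ i)
    ((({i} : Finset (Fin q)) ∪ ({k | (i, ρ k) ∈ F} : Finset (Fin q))) ∪ ({k | (k, ρ i) ∈ F} : Finset (Fin q)))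
  have h2 := card_union_le (({i} : Finset (Fin q)) ∪ ({k | (i, ρ k) ∈ F} : Finset (Fin q)))
    ({k | (k, ρ i) ∈ F} : Finset (Fin q))
  have h3 := card_union_le ({i} : Finset (Fin q)) ({k | (i, ρ k) ∈ F} : Finset (Fin q))
  have h4 := h.card_perm_le i ρ
  have h5 := h.2 (ρ i)
  rw [card_singleton] at h3
  omega

theorem mul_swap_apply_of_ne (ρ : Equiv.Perm (Fin q)) {i k l : Fin q} (hi : l ≠ i) (hk : l ≠ k) :
    (ρ * Equiv.swap i k) l = ρ l := by
  rw [Equiv.Perm.mul_apply, Equiv.swap_apply_of_ne_of_ne hi hk]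

theorem mul_swap_mem_avoiding {F : Finset (Fin q × Fin q)} {ρ : Equiv.Perm (Fin q)} {i k : Fin q}
    (hρ : ∀ l, l ≠ i → l ≠ k → (l, ρ l) ∉ F) (h1 : (i, ρ k) ∉ F) (h2 : (k, ρ i) ∉ F) :
    ρ * Equiv.swap i k ∈ avoiding F := by
  rw [mem_avoiding]
  intro l
  by_cases hi : l = i
  · subst hi
    simpa using h1
  by_cases hk : l = k
  · subst hk
    simpa using h2
  rw [mul_swap_apply_of_ne ρ hi hk]
  exact hρ l hi hk

/-- If `2 * D + 1 < q` and each line meets `F` in at most `D` cells, then some permutation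
avoids `F`. -/
theorem avoiding_nonempty {F : Finset (Fin q × Fin q)} {D : ℕ} (h : LinesLE F D)
    (hq : 2 * D + 1 < q) : (avoiding F).Nonempty := by
  induction F using Finset.induction_on with
  | empty => exact ⟨1, by simp [mem_avoiding]⟩
  | insert c F hc ih =>
    obtain ⟨ρ, hρ⟩ := ih (h.mono (subset_insert c F))
    rw [mem_avoiding] at hρ
    have hcard := le_card_switchable h ρ c.1
    obtain ⟨k, hk⟩ : (switchable (insert c F) ρ c.1).Nonempty := card_pos.1 (by omega)
    rw [mem_switchable] at hk
    -- Only row `c.1` of ρ can violate the enlarged set, and the switch rewrites that row.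
    refine ⟨_, mul_swap_mem_avoiding (fun l hl _ => ?_) hk.2.1 hk.2.2⟩
    rw [mem_insert, not_or]
    exact ⟨fun h => hl (congrArg Prod.fst h), hρ l⟩

/-- Exchange the value at `i` with the value `j`. -/
def bringValue (i j : Fin q) (τ : Equiv.Perm (Fin q)) : Equiv.Perm (Fin q) :=
  τ * Equiv.swap i (τ⁻¹ j)

theorem bringValue_apply (i j : Fin q) (τ : Equiv.Perm (Fin q)) : bringValue i j τ i = j := by
  simp [bringValue]

theorem eq_mul_swap_of_bringValue_eq {i j : Fin q} {τ ρ : Equiv.Perm (Fin q)}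
    (h : bringValue i j τ = ρ) : τ = ρ * Equiv.swap i (τ⁻¹ j) := by
  rw [← h, bringValue, mul_assoc, Equiv.swap_mul_self, mul_one]

theorem mul_swap_inv_apply {i j k : Fin q} {ρ : Equiv.Perm (Fin q)} (h : ρ i = j) :
    (ρ * Equiv.swap i k)⁻¹ j = k := by
  rw [Equiv.Perm.inv_eq_iff_eq]
  simp [h]

theorem bringValue_mul_swap {i j k : Fin q} {ρ : Equiv.Perm (Fin q)} (h : ρ i = j) :
    bringValue i j (ρ * Equiv.swap i k) = ρ := by
  rw [bringValue, mul_swap_inv_apply h, mul_assoc, Equiv.swap_mul_self, mul_one]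

variable {F : Finset (Fin q × Fin q)} {i j : Fin q}

theorem mem_avoiding_insert {ρ : Equiv.Perm (Fin q)} :
    ρ ∈ avoiding (insert (i, j) F) ↔ ρ ∈ avoiding F ∧ ρ i ≠ j := by
  simp only [mem_avoiding, mem_insert, not_or, Prod.mk.injEq]
  constructor
  · exact fun h => ⟨fun l => (h l).2, fun h' => (h i).1 ⟨rfl, h'⟩⟩
  · rintro ⟨h1, h2⟩ l
    refine ⟨?_, h1 l⟩
    rintro ⟨rfl, h⟩
    exact h2 h

variable (F i j) in
/-- The permutations that avoid `F` and send `i` to `j`. -/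
def avoidingThrough : Finset (Equiv.Perm (Fin q)) := (avoiding F).filter fun ρ => ρ i = j

theorem mem_avoidingThrough {ρ : Equiv.Perm (Fin q)} :
    ρ ∈ avoidingThrough F i j ↔ ρ ∈ avoiding F ∧ ρ i = j := by simp [avoidingThrough]

theorem card_avoiding_eq_add :
    #(avoiding F) = #(avoiding (insert (i, j) F)) + #(avoidingThrough F i j) := by
  rw [add_comm, avoidingThrough, ← card_filter_add_card_filter_not (s := avoiding F)
    (fun ρ => ρ i = j)]
  congr 2
  ext ρ
  rw [mem_avoiding_insert, mem_filter]

variable (F i j) in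
/-- The permutations that avoid `F` and the cell `(i, j)` and come from a permutation through
`(i, j)` that avoids `F` by exchanging two values. -/
def switched : Finset (Equiv.Perm (Fin q)) :=
  (avoiding (insert (i, j) F)).filter fun τ => bringValue i j τ ∈ avoidingThrough F i j

theorem mem_switched {τ : Equiv.Perm (Fin q)} :
    τ ∈ switched F i j ↔
      τ ∈ avoiding (insert (i, j) F) ∧ bringValue i j τ ∈ avoidingThrough F i j := by
  simp [switched]

/-- A permutation τ in the fiber is determined by the position of j in it. -/
theorem card_fiber_bringValue_le (s : Finset (Equiv.Perm (Fin q))) (ρ : Equiv.Perm (Fin q)) :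
    #{τ ∈ s | bringValue i j τ = ρ} ≤ q := by
  calc #{τ ∈ s | bringValue i j τ = ρ} ≤ #(univ : Finset (Fin q)) := by
        refine card_le_card_of_injOn (fun τ => τ⁻¹ j) (fun _ _ => by simp) ?_
        intro τ hτ σ hσ h
        simp only [coe_filter, Set.mem_ofPred_eq] at hτ hσ
        dsimp only at h
        rw [eq_mul_swap_of_bringValue_eq hτ.2, h, ← eq_mul_swap_of_bringValue_eq hσ.2]
    _ = q := by simp

theorem card_switched_le : #(switched F i j) ≤ q * #(avoidingThrough F i j) :=
  card_le_mul_card_image_of_maps_to (f := bringValue i j)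
    (fun _ hτ => (mem_switched.1 hτ).2) q fun ρ _ => card_fiber_bringValue_le _ ρ

/-- The pair (ρ, k) can be read off from ρ ∘ (i k): k is the position of j, and undoing the switch
returns ρ. So every admissible switch of every ρ through (i, j) gives a different element of
`switched F i j`. -/
theorem le_card_switched {D : ℕ} (h : LinesLE (insert (i, j) F) D) :
    q * #(avoidingThrough F i j) ≤
      #(switched F i j) + (2 * D + 1) * #(avoidingThrough F i j) := by
  have hF := h.mono (subset_insert (i, j) F)
  have h1 : #((avoidingThrough F i j).sigma fun ρ => switchable F ρ i) ≤ #(switched F i j) := by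
    refine card_le_card_of_injOn (fun p => p.1 * Equiv.swap i p.2) ?_ ?_
    · rintro ⟨ρ, k⟩ hp
      simp only [coe_sigma, Set.mem_sigma_iff, mem_coe, mem_avoidingThrough, mem_switchable] at hp
      obtain ⟨⟨hρ, hj⟩, hk, h1, h2⟩ := hp
      rw [mem_coe, mem_switched, bringValue_mul_swap hj, mem_avoidingThrough, mem_avoiding_insert]
      refine ⟨⟨mul_swap_mem_avoiding (fun l _ _ => mem_avoiding.1 hρ l) h1 h2, ?_⟩, hρ, hj⟩
      rw [Equiv.Perm.mul_apply, Equiv.swap_apply_left, ← hj]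
      exact fun h => hk (ρ.injective h)
    · rintro ⟨ρ, k⟩ hp ⟨ρ', k'⟩ hp' he
      simp only [coe_sigma, Set.mem_sigma_iff, mem_coe, mem_avoidingThrough] at hp hp'
      dsimp only at he
      have e1 : ρ = ρ' := by
        rw [← bringValue_mul_swap (k := k) hp.1.2, he, bringValue_mul_swap hp'.1.2]
      have e2 : k = k' := by
        rw [← mul_swap_inv_apply (k := k) hp.1.2, he, mul_swap_inv_apply hp'.1.2]
      rw [e1, e2]
  rw [card_sigma] at h1
  calc q * #(avoidingThrough F i j) = ∑ _ρ ∈ avoidingThrough F i j, q := by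
        rw [sum_const, smul_eq_mul, mul_comm]
    _ ≤ ∑ ρ ∈ avoidingThrough F i j, (#(switchable F ρ i) + (2 * D + 1)) :=
        sum_le_sum fun ρ _ => le_card_switchable hF ρ i
    _ ≤ _ := by
        rw [sum_add_distrib, sum_const, smul_eq_mul, mul_comm (#_)]
        omega

/-- If exchanging the value at `i` with the value `j` is impossible, then the cell
`(τ⁻¹ j, τ i)` is in `F`. -/
theorem mem_of_notMem_switched (hij : (i, j) ∉ F) {τ : Equiv.Perm (Fin q)}
    (hτ : τ ∈ avoiding (insert (i, j) F)) (h : τ ∉ switched F i j) : (τ⁻¹ j, τ i) ∈ F := by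
  by_contra hF
  refine h (mem_switched.2 ⟨hτ, mem_avoidingThrough.2 ⟨?_, bringValue_apply i j τ⟩⟩)
  refine mul_swap_mem_avoiding (fun l _ _ => mem_avoiding.1 (mem_avoiding_insert.1 hτ).1 l) ?_ hF
  simpa using hij

/-- An unreached τ has the cell (τ⁻¹ j, τ i) in F, which is a rare coincidence. Switching i with a
further k keeps τ in the larger set and moves the value τ i to k. In the result σ the cell (σ⁻¹ j, σ
k) lies in F, so for each σ at most D values of k occur. Counting the pairs (τ, k) both ways gives
the bound. -/
theorem card_sdiff_switched_le {D : ℕ} (h : LinesLE (insert (i, j) F) D) (hij : (i, j) ∉ F) :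
    q * #(avoiding (insert (i, j) F) \ switched F i j) ≤
      D * #(avoiding (insert (i, j) F)) +
        (2 * D + 2) * #(avoiding (insert (i, j) F) \ switched F i j) := by
  have hF := h.mono (subset_insert (i, j) F)
  set B := avoiding (insert (i, j) F) \ switched F i j with hB
  have h1 : #(B.sigma fun τ => (switchable (insert (i, j) F) τ i).erase (τ⁻¹ j)) ≤
      #((avoiding (insert (i, j) F)).sigma
        fun σ => ({k | (σ⁻¹ j, σ k) ∈ F} : Finset (Fin q))) := by
    refine card_le_card_of_injOn (fun p => ⟨p.1 * Equiv.swap i p.2, p.2⟩) ?_ ?_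
    · rintro ⟨τ, k⟩ hp
      simp only [coe_sigma, Set.mem_sigma_iff, mem_coe, mem_erase, mem_switchable, hB,
        mem_sdiff] at hp
      obtain ⟨⟨hτ, hs⟩, hkj, hki, h1, h2⟩ := hp
      have hmem := mem_of_notMem_switched hij hτ hs
      simp only [coe_sigma, Set.mem_sigma_iff, mem_coe, mem_filter, mem_univ, true_and]
      refine ⟨mul_swap_mem_avoiding (fun l _ _ => mem_avoiding.1 hτ l) h1 h2, ?_⟩
      -- The position of j is neither i, since τ avoids (i, j), nor k, which was chosen different
      -- from it.
      have e : (τ * Equiv.swap i k)⁻¹ j = τ⁻¹ j := by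
        rw [Equiv.Perm.inv_eq_iff_eq, mul_swap_apply_of_ne τ ?_ (Ne.symm hkj)]
        · simp
        · intro h
          rw [Equiv.Perm.inv_eq_iff_eq] at h
          exact (mem_avoiding_insert.1 hτ).2 h.symm
      rw [e]
      simpa using hmem
    · rintro ⟨τ, k⟩ _ ⟨τ', k'⟩ _ he
      simp only [Sigma.mk.injEq, heq_eq_eq] at he
      obtain ⟨he, rfl⟩ := he
      rw [mul_left_inj] at he
      rw [he]
  rw [card_sigma, card_sigma] at h1
  have h2 : ∑ σ ∈ avoiding (insert (i, j) F), #({k | (σ⁻¹ j, σ k) ∈ F} : Finset (Fin q)) ≤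
      D * #(avoiding (insert (i, j) F)) := by
    rw [mul_comm, ← smul_eq_mul]
    exact sum_le_card_nsmul _ _ _ fun σ _ => hF.card_perm_le _ σ
  calc q * #B = ∑ _τ ∈ B, q := by rw [sum_const, smul_eq_mul, mul_comm]
    _ ≤ ∑ τ ∈ B, (#((switchable (insert (i, j) F) τ i).erase (τ⁻¹ j)) + (2 * D + 2)) := by
        -- Excluding τ⁻¹ j as a partner raises the loss from 2D + 1 to 2D + 2.
        refine sum_le_sum fun τ _ => ?_
        have := le_card_switchable h τ i
        have := pred_card_le_card_erase (s := switchable (insert (i, j) F) τ i) (a := τ⁻¹ j)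
        omega
    _ ≤ _ := by
        rw [sum_add_distrib, sum_const, smul_eq_mul, mul_comm (#B)]
        omega

end Avoiding

/-! ### Transport cost of adding forbidden cells. -/

section AvailabilityTransport

variable {q : ℕ}

/-- The arithmetic behind the cost bound: `x`, `y`, `z`, `e` stand for the numbers of permutations
that avoid `F`, avoid `F` and a further cell, use that cell, and arise by switching. -/
theorem switching_cost_le {x y z e Q d : ℝ} (rx : 0 < x) (rz : 0 ≤ z) (rd : 1 ≤ d)
    (rq : 4 * d + 4 ≤ Q) (rxyz : x = y + z) (re1 : e ≤ Q * z)
    (re2 : Q * z ≤ e + (2 * d + 1) * z) (re3 : e ≤ y) :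
    e * ((1 - 2 * d / Q) / (Q * x)) +
      (1 - (y * x⁻¹ + e * ((1 - 2 * d / Q) / (Q * x)))) * Q ≤ 12 * d / Q := by
  have rQ : 0 < Q := by linarith
  have hβ0 : 0 ≤ 1 - 2 * d / Q := by
    rw [sub_nonneg, div_le_one rQ]
    linarith
  have hβ1 : 1 - 2 * d / Q ≤ 1 := by
    rw [sub_le_self_iff]
    positivity
  obtain ⟨w, hw⟩ : ∃ w : ℝ, w = (1 - 2 * d / Q) / (Q * x) := ⟨_, rfl⟩
  have hw0 : 0 ≤ w := by rw [hw]; positivity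
  have hwQ : Q * w ≤ x⁻¹ := by
    rw [hw, ← one_div, mul_div_assoc', mul_div_mul_left _ _ rQ.ne']
    gcongr
  rw [← hw]
  -- The switches cost at most z/x. The leftover mass is at most (z/x)(4d + 1)/Q and is charged the
  -- diameter bound Q.
  have h1 : e * w + (1 - (y * x⁻¹ + e * w)) * Q ≤ z / x * (2 + 4 * d) := by
    have h2 : e * w ≤ z / x := by
      calc e * w ≤ (Q * z) * w := by gcongr
        _ = z * (Q * w) := by ring
        _ ≤ z * x⁻¹ := by gcongr
        _ = z / x := by rw [div_eq_mul_inv]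
    have h3 : 1 - y * x⁻¹ = z / x := by
      rw [rxyz] at rx ⊢
      field_simp
      ring
    have h4 : e * w * Q = e * (1 - 2 * d / Q) / x := by
      rw [hw]
      field_simp
    have h5 : z * (Q - 2 * d - 1) * (1 - 2 * d / Q) ≤ e * (1 - 2 * d / Q) := by
      gcongr
      linarith
    have h6 : z * (Q - 4 * d - 1) ≤ z * (Q - 2 * d - 1) * (1 - 2 * d / Q) := by
      rw [mul_assoc]
      gcongr
      have : (Q - 2 * d - 1) * (1 - 2 * d / Q) = Q - 4 * d - 1 + 2 * d * (2 * d + 1) / Q := by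
        field_simp
        ring
      rw [this, le_add_iff_nonneg_right]
      positivity
    have h7 : z / x * (Q - 4 * d - 1) ≤ e * w * Q := by
      rw [h4, div_mul_eq_mul_div]
      exact div_le_div_of_nonneg_right (h6.trans h5) rx.le
    calc e * w + (1 - (y * x⁻¹ + e * w)) * Q
        = e * w + (1 - y * x⁻¹) * Q - e * w * Q := by ring
      _ ≤ z / x + z / x * Q - z / x * (Q - 4 * d - 1) := by
        rw [h3]
        linarith
      _ = z / x * (2 + 4 * d) := by ring
  refine h1.trans ?_
  -- Here z(Q - 2d - 1) ≤ e ≤ y ≤ x, and Q - 2d - 1 is at least Q/2.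
  have h8 : z / x ≤ 2 / Q := by
    rw [div_le_div_iff₀ rx rQ]
    linarith [mul_le_mul_of_nonneg_left rq rz, mul_nonneg rz (by linarith : 0 ≤ d)]
  calc z / x * (2 + 4 * d) ≤ 2 / Q * (6 * d) := by
        gcongr
        linarith
    _ = 12 * d / Q := by ring

/-- The partial plan keeps 1/x on each common permutation and puts a constant weight w on each
switch; `TransportLE.of_partial` moves the rest. -/
theorem transportLE_avoiding_insert {F : Finset (Fin q × Fin q)} {i j : Fin q} {D : ℕ}
    (h : LinesLE (insert (i, j) F) D) (hij : (i, j) ∉ F) (hD : 1 ≤ D) (hq : 4 * D + 4 ≤ q) :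
    TransportLE (fun ρ σ => (cayleyDist ρ σ : ℝ)) (uniformWeight (avoiding F))
      (uniformWeight (avoiding (insert (i, j) F))) (12 * D / q) := by
  have hX := avoiding_nonempty (h.mono (subset_insert (i, j) F)) (by omega)
  have hY := avoiding_nonempty h (by omega)
  have hxyz := card_avoiding_eq_add (F := F) (i := i) (j := j)
  have hE1 := card_switched_le (F := F) (i := i) (j := j)
  have hE2 := le_card_switched h
  have hB := card_sdiff_switched_le h hij
  have hEsub : switched F i j ⊆ avoiding (insert (i, j) F) := filter_subset _ _
  have hE3 := card_le_card hEsub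
  rw [card_sdiff_of_subset hEsub] at hB
  set X := avoiding F with hXdef
  set Y := avoiding (insert (i, j) F) with hYdef
  set Z := avoidingThrough F i j with hZdef
  set S := switched F i j with hSdef
  have hy : 0 < #Y := card_pos.2 hY
  have hx : 0 < #X := card_pos.2 hX
  have hYX : Y ⊆ X := fun ρ hρ => (mem_avoiding_insert.1 hρ).1
  obtain ⟨x, hxe⟩ : ∃ x : ℝ, x = #X := ⟨_, rfl⟩
  obtain ⟨y, hye⟩ : ∃ y : ℝ, y = #Y := ⟨_, rfl⟩
  obtain ⟨z, hze⟩ : ∃ z : ℝ, z = #Z := ⟨_, rfl⟩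
  obtain ⟨e, hee⟩ : ∃ e : ℝ, e = #S := ⟨_, rfl⟩
  obtain ⟨Q, hQe⟩ : ∃ Q : ℝ, Q = q := ⟨_, rfl⟩
  obtain ⟨d, hde⟩ : ∃ d : ℝ, d = D := ⟨_, rfl⟩
  have rx : 0 < x := by rw [hxe]; exact_mod_cast hx
  have ry : 0 < y := by rw [hye]; exact_mod_cast hy
  have rz : 0 ≤ z := by rw [hze]; positivity
  have rd : 1 ≤ d := by rw [hde]; exact_mod_cast hD
  have rq : 4 * d + 4 ≤ Q := by rw [hde, hQe]; exact_mod_cast hq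
  have rxyz : x = y + z := by rw [hxe, hye, hze]; exact_mod_cast hxyz
  have re1 : e ≤ Q * z := by rw [hee, hQe, hze]; exact_mod_cast hE1
  have re2 : Q * z ≤ e + (2 * d + 1) * z := by rw [hee, hQe, hze, hde]; exact_mod_cast hE2
  have re3 : e ≤ y := by rw [hee, hye]; exact_mod_cast hE3
  have rB : Q * (y - e) ≤ d * y + (2 * d + 2) * (y - e) := by
    rw [hee, hQe, hye, hde, ← Nat.cast_sub hE3]
    exact_mod_cast hB
  have rQ : 0 < Q := by linarith
  -- Since Q ≥ 4d + 4, the factor Q - 2d - 2 is at least Q/2.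
  have rB' : Q * (y - e) ≤ 2 * d * y := by nlinarith
  have hyz : (1 - 2 * d / Q) * y ≤ e := by
    rw [sub_mul, one_mul, div_mul_eq_mul_div, sub_le_comm, le_div_iff₀ rQ]
    linarith
  have hβ0 : 0 ≤ 1 - 2 * d / Q := by
    rw [sub_nonneg, div_le_one rQ]
    linarith
  have hβ1 : 1 - 2 * d / Q ≤ 1 := by
    rw [sub_le_self_iff]
    positivity
  -- A row has at most Q switches, so weight 1/(Qx) would respect the row sums. The factor 1 - 2d/Q
  -- makes room in the columns: 1/x + w ≤ 1/y amounts to (1 - 2d/Q) y ≤ Qz, which holds because e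
  -- lies between these two quantities.
  obtain ⟨w, hw⟩ : ∃ w : ℝ, w = (1 - 2 * d / Q) / (Q * x) := ⟨_, rfl⟩
  have hw0 : 0 ≤ w := by rw [hw]; positivity
  have hwQ : Q * w ≤ x⁻¹ := by
    rw [hw, ← one_div, mul_div_assoc', mul_div_mul_left _ _ rQ.ne']
    gcongr
  have hwy : x⁻¹ + w ≤ y⁻¹ := by
    rw [← le_sub_iff_add_le', inv_sub_inv ry.ne' rx.ne', hw, div_le_div_iff₀ (by positivity)
      (by positivity), rxyz, add_sub_cancel_left]
    have : (1 - 2 * d / Q) * y ≤ z * Q := by linarith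
    nlinarith [mul_le_mul_of_nonneg_right this (rxyz ▸ rx.le : 0 ≤ y + z)]
  let m : Equiv.Perm (Fin q) → Equiv.Perm (Fin q) → ℝ := fun ρ τ =>
    (if ρ = τ ∧ τ ∈ Y then x⁻¹ else 0) + if bringValue i j τ = ρ ∧ τ ∈ S then w else 0
  have hm0 : ∀ ρ τ, 0 ≤ m ρ τ := fun ρ τ => by
    have := rx.le
    dsimp only [m]
    split_ifs <;> positivity
  have hcol : ∀ τ, ∑ ρ, m ρ τ = (if τ ∈ Y then x⁻¹ else 0) + if τ ∈ S then w else 0 := fun τ => by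
    simp only [m, sum_add_distrib, ite_and]
    rw [Finset.sum_ite_eq', Finset.sum_ite_eq]
    simp
  have hrow : ∀ ρ, ∑ τ, m ρ τ =
      (if ρ ∈ Y then x⁻¹ else 0) + #{τ ∈ S | bringValue i j τ = ρ} * w := fun ρ => by
    simp only [m, sum_add_distrib]
    congr 1
    · simp only [ite_and]
      rw [Finset.sum_ite_eq]
      simp
    · rw [← sum_filter, sum_const, nsmul_eq_mul]
      congr 3
      ext τ
      simp [and_comm]
  have htot : ∑ ρ, ∑ τ, m ρ τ = y * x⁻¹ + e * w := by
    rw [Finset.sum_comm]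
    simp only [hcol, sum_add_distrib, hye, hee]
    simp
  have hcost : ∑ ρ, ∑ τ, m ρ τ * (cayleyDist ρ τ : ℝ) ≤ e * w := by
    calc ∑ ρ, ∑ τ, m ρ τ * (cayleyDist ρ τ : ℝ)
        ≤ ∑ ρ, ∑ τ, if bringValue i j τ = ρ ∧ τ ∈ S then w else 0 := by
          refine sum_le_sum fun ρ _ => sum_le_sum fun τ _ => ?_
          by_cases h1 : ρ = τ
          · rw [h1, cayleyDist_self, Nat.cast_zero, mul_zero]
            split_ifs <;> simp [hw0]
          · simp only [m, h1, false_and, if_false, zero_add]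
            split_ifs with h2
            · have : (cayleyDist ρ τ : ℝ) ≤ 1 := by
                rw [← h2.1, bringValue]
                exact_mod_cast cayleyDist_mul_swap_le τ i _
              nlinarith
            · simp
      _ = e * w := by
          rw [Finset.sum_comm]
          simp [ite_and, hee]
  have hdist : ∀ ρ σ : Equiv.Perm (Fin q), (cayleyDist ρ σ : ℝ) ≤ Q := fun ρ σ => by
    rw [hQe]
    exact_mod_cast cayleyDist_le ρ σ
  refine (TransportLE.of_partial hdist (sum_uniformWeight hX) (sum_uniformWeight hY) m hm0
    (fun ρ => ?_) (fun τ => ?_)).mono ?_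
  · rw [hrow, uniformWeight, ← hxe]
    by_cases hρ : ρ ∈ Y
    · have h0 : #{τ ∈ S | bringValue i j τ = ρ} = 0 := by
        rw [card_eq_zero, filter_eq_empty_iff]
        rintro τ - rfl
        exact (mem_avoiding_insert.1 hρ).2 (bringValue_apply i j τ)
      rw [if_pos hρ, if_pos (hYX hρ), h0]
      simp
    · rw [if_neg hρ, zero_add]
      by_cases hρX : ρ ∈ X
      · rw [if_pos hρX]
        refine le_trans (mul_le_mul_of_nonneg_right ?_ hw0) hwQ
        rw [hQe]
        exact_mod_cast card_fiber_bringValue_le S ρ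
      · have h0 : #{τ ∈ S | bringValue i j τ = ρ} = 0 := by
          rw [card_eq_zero, filter_eq_empty_iff]
          rintro τ hτ rfl
          exact hρX (mem_avoidingThrough.1 (mem_switched.1 hτ).2).1
        rw [if_neg hρX, h0]
        simp
  · rw [hcol, uniformWeight, ← hye]
    by_cases hτ : τ ∈ Y
    · rw [if_pos hτ, if_pos hτ]
      refine le_trans ?_ hwy
      split_ifs <;> linarith
    · rw [if_neg hτ, if_neg hτ, if_neg fun h => hτ (hEsub h), add_zero]
  · rw [htot, ← hQe, ← hde]
    refine (add_le_add_left hcost _).trans ?_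
    rw [hw]
    exact switching_cost_le rx rz rd rq rxyz re1 re2 re3

theorem transportLE_avoiding_of_subset {F F' : Finset (Fin q × Fin q)} {D : ℕ} (hF : F ⊆ F')
    (h : LinesLE F' D) (hD : 1 ≤ D) (hq : 4 * D + 4 ≤ q) :
    TransportLE (fun ρ σ => (cayleyDist ρ σ : ℝ)) (uniformWeight (avoiding F))
      (uniformWeight (avoiding F')) (#(F' \ F) * (12 * D / q)) := by
  obtain ⟨A, hA⟩ : ∃ A, A = F' \ F := ⟨_, rfl⟩
  induction A using Finset.induction_on generalizing F with
  | empty =>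
    have : F = F' := subset_antisymm hF (sdiff_eq_empty_iff_subset.1 hA.symm)
    subst this
    simpa using TransportLE.refl (fun ρ => by simp [cayleyDist_self])
      (uniformWeight_nonneg (avoiding F))
  | insert c A hc ih =>
    obtain ⟨i, j⟩ := c
    have hmem : (i, j) ∈ F' ∧ (i, j) ∉ F := mem_sdiff.1 (hA ▸ mem_insert_self _ _)
    have hsub : insert (i, j) F ⊆ F' := insert_subset hmem.1 hF
    have hA' : A = F' \ insert (i, j) F := by
      rw [sdiff_insert, ← hA, erase_insert hc]
    have h1 := transportLE_avoiding_insert (h.mono hsub) hmem.2 hD hq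
    refine (h1.trans (fun ρ σ τ => ?_) (ih hsub hA')).mono (le_of_eq ?_)
    · exact_mod_cast cayleyDist_triangle ρ σ τ
    · rw [← hA, ← hA', card_insert_of_notMem hc]
      push_cast
      ring

end AvailabilityTransport

/-! ### Forbidden cells of the availability graph. -/

section Availability

variable {V : Type*} {q : ℕ} (G : SimpleGraph V) (L : V → Finset ℕ) (hL : ∀ v, (L v).card = q)

open Classical in
/-- The cells `(i, j)` that are not edges of the availability graph at `u`. -/
noncomputable def forbidden (ω : V → Equiv.Perm (Fin q)) (u : V) : Finset (Fin q × Fin q) :=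
  univ.filter fun p => ∃ w, G.Adj u w ∧ coloring L hL ω p.1 w = listColor L hL u p.2

variable {G L hL}

theorem mem_forbidden {ω : V → Equiv.Perm (Fin q)} {u : V} {i j : Fin q} :
    (i, j) ∈ forbidden G L hL ω u ↔
      ∃ w, G.Adj u w ∧ coloring L hL ω i w = listColor L hL u j := by simp [forbidden]

theorem listColor_injective (v : V) : Function.Injective (listColor L hL v) :=
  ((L v).orderEmbOfFin (hL v)).injective

theorem perfectMatchings_availabilityGraph (ω : V → Equiv.Perm (Fin q)) (u : V) :
    perfectMatchings (availabilityGraph G L hL ω u) = avoiding (forbidden G L hL ω u) := by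
  ext ρ
  rw [mem_perfectMatchings, mem_avoiding]
  refine forall_congr' fun i => ?_
  rw [mem_forbidden]
  simp [availabilityGraph]

/-- In row i each neighbor blocks at most the one color it has under f_i. In column j each neighbor
has the given color under at most one f_i. -/
theorem linesLE_forbidden [Fintype V] [DecidableRel G.Adj] (ω : V → Equiv.Perm (Fin q)) (u : V) :
    LinesLE (forbidden G L hL ω u) (G.degree u) := by
  constructor
  · intro i
    calc #{j | (i, j) ∈ forbidden G L hL ω u}
        ≤ #((G.neighborFinset u).image (coloring L hL ω i)) := by
          refine card_le_card_of_injOn (listColor L hL u) (fun j hj => ?_)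
            (listColor_injective u).injOn
          simpa [mem_forbidden] using hj
      _ ≤ G.degree u := card_image_le
  · intro j
    have hsub : ({i | (i, j) ∈ forbidden G L hL ω u} : Finset (Fin q)) ⊆
        (G.neighborFinset u).biUnion fun w =>
          {i | coloring L hL ω i w = listColor L hL u j} := fun i hi => by
      simpa [mem_forbidden] using hi
    refine (card_le_card hsub).trans (card_biUnion_le.trans ?_)
    rw [← G.card_neighborFinset_eq_degree, card_eq_sum_ones]
    refine sum_le_sum fun w _ => card_le_one.2 fun a ha b hb => ?_
    simp only [mem_filter, mem_univ, true_and] at ha hb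
    exact (ω w).injective (listColor_injective (hL := hL) w (ha.trans hb.symm))

/-- A cell present only for ω is caused by `v`, in a row where the two permutations at `v` differ,
and the color of `v` fixes its column. So the cells inject into the rows of disagreement, at most
two per transposition. -/
theorem card_forbidden_sdiff_le {ω ω' : V → Equiv.Perm (Fin q)} {v : V}
    (h : ∀ w, w ≠ v → ω w = ω' w) (u : V) :
    #(forbidden G L hL ω u \ forbidden G L hL ω' u) ≤ 2 * cayleyDist (ω v) (ω' v) := by
  refine le_trans ?_ (card_ne_le_two_mul_cayleyDist (ω v) (ω' v))
  have key : ∀ p ∈ forbidden G L hL ω u \ forbidden G L hL ω' u,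
      coloring L hL ω p.1 v = listColor L hL u p.2 ∧ ω v p.1 ≠ ω' v p.1 := by
    rintro ⟨i, j⟩ hp
    rw [mem_sdiff, mem_forbidden, mem_forbidden] at hp
    obtain ⟨⟨w, hw, hc⟩, hn⟩ := hp
    have hwv : w = v := by
      by_contra hwv
      exact hn ⟨w, hw, by rw [← hc, coloring, coloring, h w hwv]⟩
    subst hwv
    refine ⟨hc, fun he => hn ⟨w, hw, ?_⟩⟩
    rw [← hc, coloring, coloring, he]
  refine card_le_card_of_injOn Prod.fst (fun p hp => by simpa using (key p hp).2) ?_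
  rintro ⟨i, j⟩ hp ⟨i', j'⟩ hp' (rfl : i = i')
  rw [Prod.mk.injEq]
  exact ⟨rfl, listColor_injective (hL := hL) u ((key _ hp).1.symm.trans (key _ hp').1)⟩

end Availability

end ListPacking

/-! ### The main theorem. -/

theorem mainTheorem3 :
    ∃ C : ℝ, 0 < C ∧
      ∀ (Δ q : ℕ), (q : ℝ) > C * (Δ : ℝ) ^ 2 →
      ∀ (V : Type*) [Fintype V] (G : SimpleGraph V) [DecidableRel G.Adj],
        G.maxDegree ≤ Δ →
      ∀ (L : V → Finset ℕ) (hL : ∀ w, (L w).card = q) (ω ω' : V → Equiv.Perm (Fin q)),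
        ListPacking.IsListPacking G L hL ω →
        ListPacking.IsListPacking G L hL ω' →
      ∀ v : V, (∀ w, ω w ≠ ω' w ↔ w = v) →
      ∀ u : V, G.Adj v u →
        ∃ (hX : (ListPacking.perfectMatchings
              (ListPacking.availabilityGraph G L hL ω u)).Nonempty)
          (hX' : (ListPacking.perfectMatchings
              (ListPacking.availabilityGraph G L hL ω' u)).Nonempty)
          (γ : PMF (Equiv.Perm (Fin q) × Equiv.Perm (Fin q))),
          ListPacking.IsCoupling γ (PMF.uniformOfFinset _ hX) (PMF.uniformOfFinset _ hX') ∧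
          ListPacking.expectedCayleyDist γ ≤
            (ListPacking.cayleyDist (ω v) (ω' v) : ℝ) / (2 * (Δ : ℝ)) := by
  -- At most 2ψ + 2ψ cells at cost 12 · 2Δ/q each give 96ψΔ/q; this is at most ψ/(2Δ) when q ≥
  -- 192Δ².
  refine ⟨192, by norm_num, ?_⟩
  intro Δ q hq V _ G _ hΔ L hL ω ω' _ _ v hv u huv
  have hu : G.degree u ≤ Δ := (G.degree_le_maxDegree u).trans hΔ
  have hu0 : 0 < G.degree u := (G.degree_pos_iff_exists_adj u).2 ⟨v, huv.symm⟩
  -- The neighbor `v` of `u` forces Δ ≥ 1, so the division by 2Δ is genuine.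
  have hΔ1 : 1 ≤ Δ := hu0.trans_le hu
  have hqn : 192 * Δ ^ 2 < q := by exact_mod_cast hq
  have hq4 : 4 * (Δ + Δ) + 4 ≤ q := by nlinarith
  have hlines : ListPacking.LinesLE
      (ListPacking.forbidden G L hL ω u ∪ ListPacking.forbidden G L hL ω' u) (Δ + Δ) := by
    have h := (ListPacking.linesLE_forbidden (G := G) (hL := hL) ω u).union
      (ListPacking.linesLE_forbidden (G := G) (hL := hL) ω' u)
    exact ⟨fun i => (h.1 i).trans (by omega), fun j => (h.2 j).trans (by omega)⟩
  have hX := ListPacking.avoiding_nonempty (hlines.mono subset_union_left) (by omega)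
  have hX' := ListPacking.avoiding_nonempty (hlines.mono subset_union_right) (by omega)
  have h1 := ListPacking.transportLE_avoiding_of_subset subset_union_left hlines (by omega) hq4
  have h2 := ListPacking.transportLE_avoiding_of_subset subset_union_right hlines (by omega) hq4
  rw [union_sdiff_left] at h1
  rw [union_sdiff_right] at h2
  have h3 := h1.trans (fun ρ σ τ => by exact_mod_cast ListPacking.cayleyDist_triangle ρ σ τ)
    (h2.symm fun ρ σ => by rw [ListPacking.cayleyDist_comm])
  have hne : ∀ w, w ≠ v → ω w = ω' w := fun w hw => not_not.1 fun h => hw ((hv w).1 h)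
  have c1 := ListPacking.card_forbidden_sdiff_le (G := G) (hL := hL)
    (fun w hw => (hne w hw).symm) u
  rw [ListPacking.cayleyDist_comm] at c1
  have c2 := ListPacking.card_forbidden_sdiff_le (G := G) (hL := hL) hne u
  have h4 := h3.mono (c' := (ListPacking.cayleyDist (ω v) (ω' v) : ℝ) / (2 * (Δ : ℝ))) (by
    have r1 : (#(ListPacking.forbidden G L hL ω' u \ ListPacking.forbidden G L hL ω u) : ℝ) ≤
        2 * ListPacking.cayleyDist (ω v) (ω' v) := by exact_mod_cast c1
    have r2 : (#(ListPacking.forbidden G L hL ω u \ ListPacking.forbidden G L hL ω' u) : ℝ) ≤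
        2 * ListPacking.cayleyDist (ω v) (ω' v) := by exact_mod_cast c2
    have rΔ : (1 : ℝ) ≤ Δ := by exact_mod_cast hΔ1
    have rq : (0 : ℝ) < q := by nlinarith
    rw [← add_mul]
    calc _ ≤ (2 * (ListPacking.cayleyDist (ω v) (ω' v) : ℝ) +
            2 * ListPacking.cayleyDist (ω v) (ω' v)) * (12 * ((Δ + Δ : ℕ) : ℝ) / q) := by gcongr
      _ = ListPacking.cayleyDist (ω v) (ω' v) * (96 * Δ / q) := by
          push_cast
          ring
      _ ≤ ListPacking.cayleyDist (ω v) (ω' v) * (1 / (2 * Δ)) := by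
          refine mul_le_mul_of_nonneg_left ?_ (Nat.cast_nonneg _)
          rw [div_le_div_iff₀ rq (by positivity)]
          linarith
      _ = _ := by ring)
  rw [← ListPacking.perfectMatchings_availabilityGraph] at hX hX' h4
  rw [← ListPacking.perfectMatchings_availabilityGraph] at h4
  obtain ⟨γ, g1, g2, g3⟩ := h4.exists_coupling hX hX'
  exact ⟨hX, hX', γ, ⟨g1, g2⟩, g3⟩
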